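/- Let $G$ be any graph (simple, not necessarily connected, of arbitrary cardinality). A ray of $G$ is a one-way infinite path; two rays are equivalent if no finite set of vertices separates them, and the equivalence classes of rays are the ends of $G$. For every finite set $X$ of vertices and every end $\omega$ there is a unique component $C(X,\omega)$ of $G-X$ containing a tail of every ray in $\omega$. The end space $\Omega(G)$ is the set of ends of $G$ with the topology that has as a basis the sets $\Omega(X,C)=\{\omega : C(X,\omega)=C\}$, where $X$ is a finite set of vertices and $C$ is a component of $G-X$. Call a topological space ultra-paracompact if it is Hausdorff and every open cover of it has a refinement that is a partition of the space into non-empty open sets. Then $\Omega(G)$ is hereditarily ultra-paracompact; that is, every subspace of $\Omega(G)$ is ultra-paracompact. -/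

import Mathlib

universe u

namespace SimpleGraph

variable {V : Type u} {G : SimpleGraph V}

/-- A ray of `G`: a one-way infinite path, listed from its first vertex. -/
structure Ray (G : SimpleGraph V) where
  vert : ℕ → V
  injective : Function.Injective vert
  adj : ∀ n, G.Adj (vert n) (vert (n + 1))

namespace Ray

/-- The set `X` of vertices separates the rays `R` and `S`: every walk from a vertex of `R` to a
vertex of `S` meets `X`. -/
def SeparatedBy (R S : G.Ray) (X : Set V) : Prop :=
  ∀ (m n : ℕ) (p : G.Walk (R.vert m) (S.vert n)), ∃ v ∈ p.support, v ∈ X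

/-- Two rays are equivalent if no finite set of vertices separates them. -/
def Equivalent (R S : G.Ray) : Prop :=
  ∀ X : Finset V, ¬ R.SeparatedBy S (X : Set V)

/-- The component `C` of `G - X` contains a tail of the ray `R`. -/
def HasTailIn {X : Set V} (R : G.Ray) (C : G.ComponentCompl X) : Prop :=
  ∃ N, ∀ n, N ≤ n → R.vert n ∈ C

theorem exists_hasTailIn (R : G.Ray) (X : Finset V) :
    ∃ C : G.ComponentCompl (X : Set V), R.HasTailIn C := by
  have hfin : {n | R.vert n ∈ (X : Set V)}.Finite :=
    X.finite_toSet.preimage R.injective.injOn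
  obtain ⟨N, hN⟩ := hfin.bddAbove
  have hout : ∀ n, N + 1 ≤ n → R.vert n ∉ (X : Set V) := fun n hn h => by
    have := hN h
    omega
  refine ⟨G.componentComplMk (hout (N + 1) le_rfl), N + 1, fun n hn => ?_⟩
  induction n, hn using Nat.le_induction with
  | base => exact ⟨_, rfl⟩
  | succ n hn ih => exact ComponentCompl.mem_of_adj _ _ ih (hout _ (by omega)) (R.adj n)

theorem HasTailIn.unique {R : G.Ray} {X : Set V} {C D : G.ComponentCompl X}
    (hC : R.HasTailIn C) (hD : R.HasTailIn D) : C = D := by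
  obtain ⟨M, hM⟩ := hC
  obtain ⟨N, hN⟩ := hD
  obtain ⟨_, h⟩ := hM _ (le_max_left M N)
  obtain ⟨_, h'⟩ := hN _ (le_max_right M N)
  exact h.symm.trans h'

theorem mem_component_of_walk {X : Set V} (C : G.ComponentCompl X) {u v : V} (p : G.Walk u v)
    (hp : ∀ w ∈ p.support, w ∉ X) (hu : u ∈ C) : v ∈ C := by
  induction p with
  | nil => exact hu
  | cons h q ih =>
    refine ih (fun w hw => hp w (by simp [hw])) ?_
    exact ComponentCompl.mem_of_adj _ _ hu (hp _ (by simp)) h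

theorem exists_walk_of_mem_component {X : Set V} {C : G.ComponentCompl X} {u v : V}
    (hu : u ∈ C) (hv : v ∈ C) : ∃ p : G.Walk u v, ∀ w ∈ p.support, w ∉ X := by
  obtain ⟨huX, hu⟩ := hu
  obtain ⟨hvX, hv⟩ := hv
  have key : ∀ a b : (Xᶜ : Set V), (G.induce Xᶜ).Walk a b →
      ∃ p : G.Walk (a : V) (b : V), ∀ w ∈ p.support, w ∉ X := by
    intro a b q
    induction q with
    | @nil a => exact ⟨Walk.nil, fun w hw => by
        obtain rfl : w = (a : V) := by simpa using hw
        exact a.2⟩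
    | @cons a b c h q ih =>
      obtain ⟨p, hp⟩ := ih
      have hab : G.Adj (a : V) (b : V) := h
      refine ⟨Walk.cons hab p, fun w hw => ?_⟩
      rw [Walk.support_cons, List.mem_cons] at hw
      rcases hw with rfl | hw
      · exact a.2
      · exact hp w hw
  obtain ⟨q⟩ := ConnectedComponent.exact (hu.trans hv.symm)
  exact key _ _ q

theorem equivalent_iff {R S : G.Ray} :
    R.Equivalent S ↔
      ∀ X : Finset V, ∃ C : G.ComponentCompl (X : Set V), R.HasTailIn C ∧ S.HasTailIn C := by
  classical
  constructor
  · intro h X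
    obtain ⟨C, M, hM⟩ := R.exists_hasTailIn X
    obtain ⟨D, N, hN⟩ := S.exists_hasTailIn X
    have h' := h (X ∪ (Finset.range M).image R.vert ∪ (Finset.range N).image S.vert)
    unfold SeparatedBy at h'
    push Not at h'
    obtain ⟨m, n, p, hp⟩ := h'
    have hm : M ≤ m := by
      by_contra hlt
      exact hp _ p.start_mem_support (by
        simp only [Finset.coe_union, Finset.coe_image, Set.mem_union, Set.mem_image]
        exact Or.inl (Or.inr ⟨m, by simpa using hlt, rfl⟩))
    have hn : N ≤ n := by
      by_contra hlt
      exact hp _ p.end_mem_support (by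
        simp only [Finset.coe_union, Finset.coe_image, Set.mem_union, Set.mem_image]
        exact Or.inr ⟨n, by simpa using hlt, rfl⟩)
    have hpX : ∀ w ∈ p.support, w ∉ (X : Set V) := fun w hw hX =>
      hp w hw (by simp only [Finset.coe_union, Set.mem_union]; exact Or.inl (Or.inl hX))
    obtain ⟨_, h1⟩ := mem_component_of_walk C p hpX (hM m hm)
    obtain ⟨_, h2⟩ := hN n hn
    obtain rfl : C = D := h1.symm.trans h2
    exact ⟨C, ⟨M, hM⟩, ⟨N, hN⟩⟩
  · intro h X hsep
    obtain ⟨C, ⟨M, hM⟩, ⟨N, hN⟩⟩ := h X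
    obtain ⟨p, hp⟩ := exists_walk_of_mem_component (hM M le_rfl) (hN N le_rfl)
    obtain ⟨v, hv, hvX⟩ := hsep M N p
    exact hp v hv hvX

theorem equivalent_equivalence : Equivalence (Equivalent (G := G)) where
  refl R := equivalent_iff.2 fun X => (R.exists_hasTailIn X).imp fun _ h => ⟨h, h⟩
  symm h := equivalent_iff.2 fun X => (equivalent_iff.1 h X).imp fun _ h => h.symm
  trans h h' := equivalent_iff.2 fun X => by
    obtain ⟨C, hR, hS⟩ := equivalent_iff.1 h X
    obtain ⟨D, hS', hT⟩ := equivalent_iff.1 h' X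
    obtain rfl := hS.unique hS'
    exact ⟨C, hR, hT⟩

/-- The equivalence relation on rays whose classes are the ends. -/
def setoid (G : SimpleGraph V) : Setoid G.Ray := ⟨Equivalent, equivalent_equivalence⟩

end Ray

/-- The set `Ω(G)` of ends of `G`: the equivalence classes of rays. -/
def EndSpace (G : SimpleGraph V) : Type u := Quotient (Ray.setoid G)

namespace EndSpace

/-- The end that a ray belongs to. -/
def mk (R : G.Ray) : G.EndSpace := Quotient.mk (Ray.setoid G) R

theorem mk_eq_mk {R S : G.Ray} : mk R = mk S ↔ R.Equivalent S :=
  ⟨fun h => Quotient.exact h, fun h => Quotient.sound (s := Ray.setoid G) h⟩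

theorem existsUnique_component (X : Finset V) (ω : G.EndSpace) :
    ∃! C : G.ComponentCompl (X : Set V), ∀ R : G.Ray, mk R = ω → R.HasTailIn C := by
  obtain ⟨S, rfl⟩ : ∃ S, mk S = ω := Quotient.exists_rep ω
  obtain ⟨C, hC⟩ := S.exists_hasTailIn X
  refine ⟨C, fun R hR => ?_, fun D hD => (hD S rfl).unique hC⟩
  obtain ⟨D, hRD, hSD⟩ := Ray.equivalent_iff.1 (mk_eq_mk.1 hR) X
  obtain rfl := hSD.unique hC
  exact hRD

/-- `C(X, ω)`: the unique component of `G - X` that contains a tail of every ray in `ω`. -/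
noncomputable def component (X : Finset V) (ω : G.EndSpace) : G.ComponentCompl (X : Set V) :=
  (existsUnique_component X ω).choose

/-- `Ω(X, C)`: the set of ends `ω` with `C(X, ω) = C`. -/
def endsIn (X : Finset V) (C : G.ComponentCompl (X : Set V)) : Set G.EndSpace :=
  {ω | component X ω = C}

/-- The topology on `Ω(G)` generated by the sets `Ω(X, C)`, where `X` is a finite set of vertices
and `C` is a component of `G - X`. These sets form a basis, by `isTopologicalBasis` below. -/
instance : TopologicalSpace G.EndSpace :=
  TopologicalSpace.generateFrom {U | ∃ X C, U = endsIn X C}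

theorem component_mk_eq_iff {X : Finset V} {R : G.Ray} {C : G.ComponentCompl (X : Set V)} :
    component X (mk R) = C ↔ R.HasTailIn C := by
  have h := (existsUnique_component X (mk R)).choose_spec.1 R rfl
  exact ⟨fun e => e ▸ h, fun h' => h.unique h'⟩

theorem component_eq_of_subset {X Y : Finset V} (hXY : X ⊆ Y) {ω η : G.EndSpace}
    (h : component Y ω = component Y η) : component X ω = component X η := by
  obtain ⟨R, rfl⟩ : ∃ R, mk R = ω := Quotient.exists_rep ω
  obtain ⟨S, rfl⟩ : ∃ S, mk S = η := Quotient.exists_rep η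
  obtain ⟨M, hM⟩ := component_mk_eq_iff.1 h
  obtain ⟨N, hN⟩ := component_mk_eq_iff.1 (rfl : component Y (mk S) = _)
  obtain ⟨A, hA⟩ := component_mk_eq_iff.1 (rfl : component X (mk R) = _)
  obtain ⟨B, hB⟩ := component_mk_eq_iff.1 (rfl : component X (mk S) = _)
  obtain ⟨p, hp⟩ := Ray.exists_walk_of_mem_component (hM _ (le_max_left M A))
    (hN _ (le_max_left N B))
  obtain ⟨_, h1⟩ := Ray.mem_component_of_walk _ p (fun w hw hX => hp w hw (hXY hX))
    (hA _ (le_max_right M A))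
  obtain ⟨_, h2⟩ := hB _ (le_max_right N B)
  exact h1.symm.trans h2

theorem isTopologicalBasis :
    TopologicalSpace.IsTopologicalBasis {U : Set G.EndSpace | ∃ X C, U = endsIn X C} where
  exists_subset_inter := by
    classical
    rintro _ ⟨X, C, rfl⟩ _ ⟨Y, D, rfl⟩ ω ⟨hC, hD⟩
    refine ⟨_, ⟨X ∪ Y, component (X ∪ Y) ω, rfl⟩, rfl, fun η hη => ⟨?_, ?_⟩⟩
    · exact (component_eq_of_subset Finset.subset_union_left hη).trans hC
    · exact (component_eq_of_subset Finset.subset_union_right hη).trans hD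
  sUnion_eq := Set.eq_univ_of_forall fun ω => ⟨_, ⟨∅, component ∅ ω, rfl⟩, rfl⟩
  eq_generateFrom := rfl

end EndSpace

end SimpleGraph

/-- A topological space is ultra-paracompact if it is Hausdorff and every open cover has a
refinement by an open partition, that is, by a partition of the space into non-empty open sets. -/
structure UltraParacompactSpace (X : Type u) [TopologicalSpace X] : Prop where
  t2 : T2Space X
  exists_open_partition : ∀ U : Set (Set X), (∀ u ∈ U, IsOpen u) → ⋃₀ U = Set.univ →
    ∃ P : Set (Set X), Setoid.IsPartition P ∧ (∀ p ∈ P, IsOpen p) ∧ ∀ p ∈ P, ∃ u ∈ U, p ⊆ u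

/-- A topological space is hereditarily ultra-paracompact if every subspace of it is
ultra-paracompact. -/
def HereditarilyUltraParacompactSpace (X : Type u) [TopologicalSpace X] : Prop :=
  ∀ S : Set X, UltraParacompactSpace S

/-!
Write `∂D` for the set of vertices outside `D` with a neighbour in `D`. Sets `D` with finite boundary
are closed under finite unions, and every end either lives in `D` (its rays have tails in `D`) or
has all its rays outside `D` eventually. Given a cover of a subspace `S` of `Ω(G)`, let `B` be the
family of basic open sets whose trace on `S` refines the cover, and let `O = ⋃ B`, which is open
and contains `S`. It suffices to partition `O` into open sets each of which is covered by finitely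
many members of `B`: as the members of `B` are clopen, every such part can be divided further into
finitely many open sets that each lie in a member of `B`. The partition is found in two stages.

*Splitting off the ends outside `O`* (`exists_componentIn_partition`). Let `U` be the vertex set of a
maximal family of disjoint rays belonging to ends outside `O`, and let `W` be the set of vertices that
finite sets can separate from `U`. If a component of `W` had infinite boundary, it would contain a
ray that cannot be separated from `U` by a finite set (`exists_ray_of_infinite_outerBoundary`). The
end of that ray is outside `O`, which contradicts the maximality of the family. So the components of
`W` have finite boundary, and the sets of ends living in them partition `O`.

*Deleting finite sets inside such a component* (`exists_good_component`). Call `D` good if `∂D` is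
finite and finitely many members of `B` cover the ends living in `D`. Fix for each vertex `v` that
lies in a good set one good set `E v` containing it. Starting with the boundary of a component of `W`,
delete larger and larger finite sets `X 0 ⊆ X 1 ⊆ ...`, where `X (n + 1)` contains `∂(E v)` for all
`v ∈ X n` and is otherwise chosen inside the component `C n` of `G - X n` that is under
consideration, so that the newly deleted sets are connected to each other; stop as soon as `C n` is
good. If this did not stop, there would be a ray in `M = ⋃ X n` with a tail in every `C n`.
Its end is in `O`, so the ray has a tail in some good set `D`. The heart of the proof is that `D`
can then be chosen with `∂D ⊆ M` (`Good.exists_outerBoundary_subset`): take `D` with as few vertices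
of `∂D` outside `M` as possible. For `v ∈ M ∩ D`, the set `E v` avoids `∂D \ M`, since otherwise
`D ∪ E v` would be a better choice. Hence the boundary of `D ∩ ⋃ E v`, the union being over all
`v ∈ M ∩ D`, lies in `∂D ∩ M`, and this set is good and contains a tail of the ray. Now `∂D` is a
finite subset of `M`, so it lies in some `X n`, and then the connected set `C n` lies in `D` and
is good after all.

The set deleted next depends only on `X n` and `C n`. Therefore two ends that live in the same final
component have undergone the same deletions, and the final components partition the ends.
-/

open Filter

namespace SimpleGraph

variable {V : Type u} {G : SimpleGraph V}

/-! ### Boundaries and connected vertex sets -/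

/-- The outer vertex boundary of `D`: the vertices outside `D` with a neighbour in `D`. -/
def outerBoundary (G : SimpleGraph V) (D : Set V) : Set V :=
  {x | x ∉ D ∧ ∃ y ∈ D, G.Adj y x}

/-- The vertices `a` and `b` are joined by a walk all of whose vertices lie in `A`. -/
def ReachableIn (G : SimpleGraph V) (A : Set V) (a b : V) : Prop :=
  ∃ p : G.Walk a b, ∀ x ∈ p.support, x ∈ A

/-- The set `A` of vertices induces a connected subgraph; the empty set is allowed. -/
def IsConnectedSet (G : SimpleGraph V) (A : Set V) : Prop :=
  ∀ a ∈ A, ∀ b ∈ A, G.ReachableIn A a b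

theorem ReachableIn.refl {A : Set V} {a : V} (ha : a ∈ A) : G.ReachableIn A a a :=
  ⟨Walk.nil, fun x hx => by
    obtain rfl : x = a := by simpa using hx
    exact ha⟩

theorem ReachableIn.symm {A : Set V} {a b : V} (h : G.ReachableIn A a b) :
    G.ReachableIn A b a := by
  obtain ⟨p, hp⟩ := h
  exact ⟨p.reverse, fun x hx => hp x (by simpa using hx)⟩

theorem ReachableIn.trans {A : Set V} {a b c : V} (h : G.ReachableIn A a b)
    (h' : G.ReachableIn A b c) : G.ReachableIn A a c := by
  obtain ⟨p, hp⟩ := h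
  obtain ⟨q, hq⟩ := h'
  refine ⟨p.append q, fun x hx => ?_⟩
  rcases (Walk.mem_support_append_iff p q).1 hx with hx | hx
  · exact hp x hx
  · exact hq x hx

theorem ReachableIn.mono {A B : Set V} (hAB : A ⊆ B) {a b : V} (h : G.ReachableIn A a b) :
    G.ReachableIn B a b := by
  obtain ⟨p, hp⟩ := h
  exact ⟨p, fun x hx => hAB (hp x hx)⟩

theorem ReachableIn.left_mem {A : Set V} {a b : V} (h : G.ReachableIn A a b) : a ∈ A := by
  obtain ⟨p, hp⟩ := h
  exact hp a p.start_mem_support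

theorem ReachableIn.right_mem {A : Set V} {a b : V} (h : G.ReachableIn A a b) : b ∈ A :=
  h.symm.left_mem

theorem ReachableIn.of_adj {A : Set V} {a b : V} (ha : a ∈ A) (hb : b ∈ A) (h : G.Adj a b) :
    G.ReachableIn A a b :=
  ⟨h.toWalk, fun x hx => by
    have : x = a ∨ x = b := by simpa using hx
    rcases this with rfl | rfl <;> assumption⟩

theorem ReachableIn.exists_crossing {A D : Set V} {a b : V} (h : G.ReachableIn A a b)
    (ha : a ∈ D) (hb : b ∉ D) : ∃ x y, x ∈ D ∧ y ∉ D ∧ x ∈ A ∧ y ∈ A ∧ G.Adj x y := by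
  obtain ⟨p, hp⟩ := h
  obtain ⟨d, hd, h1, h2⟩ := p.exists_boundary_dart D ha hb
  exact ⟨d.fst, d.snd, h1, h2, hp _ (p.dart_fst_mem_support_of_mem_darts hd),
    hp _ (p.dart_snd_mem_support_of_mem_darts hd), d.adj⟩

theorem ReachableIn.mem_of_disjoint {A D : Set V} {a b : V} (h : G.ReachableIn A a b)
    (hAD : Disjoint A (G.outerBoundary D)) (ha : a ∈ D) : b ∈ D := by
  by_contra hb
  obtain ⟨x, y, hx, hy, -, hyA, hxy⟩ := h.exists_crossing ha hb
  exact Set.disjoint_left.1 hAD hyA ⟨hy, x, hx, hxy⟩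

theorem IsConnectedSet.subset_of_disjoint {A D : Set V} (hA : G.IsConnectedSet A)
    (hAD : Disjoint A (G.outerBoundary D)) (hne : (A ∩ D).Nonempty) : A ⊆ D := by
  obtain ⟨a, haA, haD⟩ := hne
  exact fun b hb => (hA a haA b hb).mem_of_disjoint hAD haD

/-- The component of `a` in the subgraph induced by `A`. -/
def componentIn (G : SimpleGraph V) (A : Set V) (a : V) : Set V :=
  {b | G.ReachableIn A a b}

theorem componentIn_subset {A : Set V} {a : V} : G.componentIn A a ⊆ A :=
  fun _ hb => ReachableIn.right_mem hb

theorem ReachableIn.to_componentIn {A : Set V} {a b : V} (h : G.ReachableIn A a b) :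
    G.ReachableIn (G.componentIn A a) a b := by
  classical
  obtain ⟨p, hp⟩ := h
  exact ⟨p, fun x hx =>
    ⟨p.takeUntil x hx, fun y hy => hp y (p.support_takeUntil_subset_support hx hy)⟩⟩

theorem isConnectedSet_componentIn (A : Set V) (a : V) :
    G.IsConnectedSet (G.componentIn A a) :=
  fun _ hb _ hc => (ReachableIn.to_componentIn hb).symm.trans (ReachableIn.to_componentIn hc)

theorem outerBoundary_componentIn_disjoint {A : Set V} {a : V} :
    Disjoint A (G.outerBoundary (G.componentIn A a)) := by
  refine Set.disjoint_left.2 ?_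
  rintro x hx ⟨hxn, y, hy, hyx⟩
  exact hxn (ReachableIn.trans hy (ReachableIn.of_adj (componentIn_subset hy) hx hyx))

theorem componentIn_eq_of_mem {A : Set V} {a b : V} (h : b ∈ G.componentIn A a) :
    G.componentIn A b = G.componentIn A a :=
  Set.ext fun _ => ⟨fun hc => ReachableIn.trans h hc,
    fun hc => ReachableIn.trans (ReachableIn.symm h) hc⟩

theorem outerBoundary_union_subset (D E : Set V) :
    G.outerBoundary (D ∪ E) ⊆ (G.outerBoundary D \ E) ∪ (G.outerBoundary E \ D) := by
  rintro x ⟨hx, y, hy | hy, hyx⟩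
  · exact Or.inl ⟨⟨fun h => hx (Or.inl h), y, hy, hyx⟩, fun h => hx (Or.inr h)⟩
  · exact Or.inr ⟨⟨fun h => hx (Or.inr h), y, hy, hyx⟩, fun h => hx (Or.inl h)⟩

theorem outerBoundary_biUnion_subset {ι : Type*} (s : Set ι) (D : ι → Set V) :
    G.outerBoundary (⋃ i ∈ s, D i) ⊆ ⋃ i ∈ s, G.outerBoundary (D i) := by
  rintro x ⟨hx, y, hy, hyx⟩
  simp only [Set.mem_iUnion, exists_prop, not_exists, not_and] at hx hy ⊢
  obtain ⟨i, hi, hyi⟩ := hy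
  exact ⟨i, hi, hx i hi, y, hyi, hyx⟩

theorem outerBoundary_empty : G.outerBoundary ∅ = ∅ := by
  ext x
  simp [outerBoundary]

/-- Finitely many vertices of a connected set lie in a finite connected subset of it. -/
theorem IsConnectedSet.exists_finite_isConnectedSet {C Q : Set V} (hC : G.IsConnectedSet C)
    (hQ : Q.Finite) (hQC : Q ⊆ C) :
    ∃ A : Set V, A.Finite ∧ Q ⊆ A ∧ A ⊆ C ∧ G.IsConnectedSet A := by
  classical
  rcases Q.eq_empty_or_nonempty with rfl | ⟨c, hc⟩
  · exact ⟨∅, Set.finite_empty, subset_rfl, Set.empty_subset _, fun a ha => ha.elim⟩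
  choose p hp using fun q : Q => hC c (hQC hc) q (hQC q.2)
  refine ⟨⋃ q : Q, {x | x ∈ (p q).support}, ?_, fun q hq => ?_, ?_, ?_⟩
  · have := hQ.to_subtype
    exact Set.finite_iUnion fun q => List.finite_toSet _
  · exact Set.mem_iUnion.2 ⟨⟨q, hq⟩, (p ⟨q, hq⟩).end_mem_support⟩
  · exact Set.iUnion_subset fun q x hx => hp q x hx
  · have key : ∀ x ∈ ⋃ q : Q, {x | x ∈ (p q).support},
        G.ReachableIn (⋃ q : Q, {x | x ∈ (p q).support}) c x := by
      intro x hx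
      obtain ⟨q, hx⟩ := Set.mem_iUnion.1 hx
      exact ⟨(p q).takeUntil x hx, fun y hy =>
        Set.mem_iUnion.2 ⟨q, (p q).support_takeUntil_subset_support hx hy⟩⟩
    exact fun a ha b hb => (key a ha).symm.trans (key b hb)

/-! ### Constructing rays -/

/-- An infinite walk that visits every vertex only finitely often contains a ray. -/
theorem Ray.exists_of_walk (w : ℕ → V) (hadj : ∀ t, G.Adj (w t) (w (t + 1)))
    (hfin : ∀ v, {t | w t = v}.Finite) :
    ∃ (R : G.Ray) (τ : ℕ → ℕ), StrictMono τ ∧ ∀ n, R.vert n = w (τ n) := by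
  -- The ray jumps from each vertex on its way to the last visit of that vertex.
  have hlast : ∀ s, ∃ t, s ≤ t ∧ w t = w s ∧ ∀ t', t < t' → w t' ≠ w s := by
    intro s
    obtain ⟨t, ht, hmax⟩ := Set.exists_max_image _ id (hfin (w s)) ⟨s, rfl⟩
    exact ⟨t, hmax s rfl, ht, fun t' htt' h => absurd (hmax t' h) (not_le.2 htt')⟩
  choose l hsl hwl hl using hlast
  let τ : ℕ → ℕ := fun n => Nat.rec (l 0) (fun _ t => l (t + 1)) n
  have hτs : ∀ n, τ (n + 1) = l (τ n + 1) := fun n => rfl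
  have hτ : StrictMono τ := strictMono_nat_of_lt_succ fun n => by
    rw [hτs]
    exact hsl (τ n + 1)
  have hτl : ∀ n t', τ n < t' → w t' ≠ w (τ n) := by
    intro n t' h
    cases n with
    | zero => exact fun e => hl 0 t' h (e.trans (hwl 0))
    | succ n => exact fun e => hl (τ n + 1) t' h (e.trans (hwl (τ n + 1)))
  refine ⟨⟨fun n => w (τ n), ?_, fun n => ?_⟩, τ, hτ, fun n => rfl⟩
  · intro m n e
    rcases lt_trichotomy m n with h | h | h
    · exact absurd e.symm (hτl m (τ n) (hτ h))
    · exact h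
    · exact absurd e (hτl n (τ m) (hτ h))
  · rw [hτs, hwl]
    exact hadj _

/-- A decreasing sequence of non-empty connected sets with empty intersection contains a ray that
has a tail in each of them. -/
theorem Ray.exists_of_antitone (K : ℕ → Set V) (hK : Antitone K) (hne : ∀ n, (K n).Nonempty)
    (hconn : ∀ n, G.IsConnectedSet (K n)) (hempty : ∀ v, ∃ n, v ∉ K n) :
    ∃ R : G.Ray, (∀ n, R.vert n ∈ K 0) ∧ ∀ n, ∀ᶠ i in atTop, R.vert i ∈ K n := by
  choose a ha using hne
  choose m hm using hempty
  let φ : ℕ → ℕ := fun i => Nat.rec 0 (fun _ n => m (a n)) i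
  have hφs : ∀ i, φ (i + 1) = m (a (φ i)) := fun i => rfl
  have hout : ∀ i, a (φ i) ∉ K (φ (i + 1)) := fun i => by
    rw [hφs]
    exact hm _
  have hφ : StrictMono φ := strictMono_nat_of_lt_succ fun i => by
    by_contra h
    exact hout i (hK (not_lt.1 h) (ha _))
  choose p hp using fun i =>
    hconn (φ i) (a (φ i)) (ha _) (a (φ (i + 1))) (hK (hφ.monotone i.le_succ) (ha _))
  have hlen : ∀ i, 0 < (p i).length := fun i => by
    rw [Nat.pos_iff_ne_zero]
    intro h
    exact hout i ((Walk.eq_of_length_eq_zero h) ▸ ha (φ (i + 1)))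
  -- The walks `p i` are non-trivial, so their concatenations `q i` are prefixes of an infinite walk.
  let q : ∀ i, G.Walk (a (φ 0)) (a (φ i)) := fun i =>
    Nat.rec (motive := fun i => G.Walk (a (φ 0)) (a (φ i))) Walk.nil (fun i r => r.append (p i)) i
  have hqs : ∀ i, q (i + 1) = (q i).append (p i) := fun i => rfl
  have hL : StrictMono fun i => (q i).length := strictMono_nat_of_lt_succ fun i => by
    rw [hqs, Walk.length_append]
    have := hlen i
    omega
  have hpre : ∀ i j, i ≤ j → ∀ t, t ≤ (q i).length → (q j).getVert t = (q i).getVert t := by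
    intro i j hij
    induction j, hij using Nat.le_induction with
    | base => exact fun t _ => rfl
    | succ j hij ih =>
      intro t ht
      have htj : t ≤ (q j).length := ht.trans (hL.monotone hij)
      rw [← ih t ht, hqs, Walk.getVert_append]
      split_ifs with h
      · rfl
      · obtain rfl : t = (q j).length := by omega
        simp
  let w : ℕ → V := fun t => (q t).getVert t
  have hw : ∀ i t, t ≤ (q i).length → w t = (q i).getVert t := by
    intro i t ht
    rcases le_total i t with h | h
    · exact hpre i t h t ht
    · exact (hpre t i h t (hL.id_le t)).symm
  have hadj : ∀ t, G.Adj (w t) (w (t + 1)) := by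
    intro t
    have h := hL.id_le (t + 1)
    simp only [id] at h
    rw [hw (t + 1) t (by omega), hw (t + 1) (t + 1) h]
    exact (q (t + 1)).adj_getVert_succ (by omega)
  have htail : ∀ i j, i ≤ j → ∀ t, (q i).length ≤ t → t ≤ (q j).length →
      (q j).getVert t ∈ K (φ i) := by
    intro i j hij
    induction j, hij using Nat.le_induction with
    | base =>
      intro t h1 h2
      obtain rfl : t = (q i).length := le_antisymm h2 h1
      simpa using ha (φ i)
    | succ j hij ih =>
      intro t h1 h2
      rw [hqs, Walk.getVert_append]
      split_ifs with h
      · exact ih t h1 h.le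
      · exact hK (hφ.monotone hij) (hp j _ (Walk.getVert_mem_support _ _))
  have hwK : ∀ i t, (q i).length ≤ t → w t ∈ K (φ i) := by
    intro i t h
    have hit : i ≤ t := (hL.id_le i).trans h
    exact htail i t hit t h (hL.id_le t)
  have hwK' : ∀ n t, (q n).length ≤ t → w t ∈ K n := fun n t h => hK (hφ.id_le n) (hwK n t h)
  have hfin : ∀ v, {t | w t = v}.Finite := by
    intro v
    refine (Set.finite_lt_nat (q (m v)).length).subset ?_
    rintro t rfl
    by_contra h
    exact hm _ (hwK' _ t (not_lt.1 h))
  obtain ⟨R, τ, hτ, hR⟩ := Ray.exists_of_walk w hadj hfin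
  refine ⟨R, fun n => ?_, fun n => ?_⟩
  · rw [hR]
    exact hwK' 0 _ (Nat.zero_le _)
  · filter_upwards [eventually_ge_atTop (q n).length] with i hi
    rw [hR]
    exact hwK' n _ (hi.trans (hτ.id_le i))

/-! ### Ends living in a vertex set -/

theorem Ray.eventually_notMem (R : G.Ray) {F : Set V} (hF : F.Finite) :
    ∀ᶠ n in atTop, R.vert n ∉ F := by
  rw [← Nat.cofinite_eq_atTop]
  exact R.injective.tendsto_cofinite.eventually hF.compl_mem_cofinite

theorem Ray.hasTailIn_iff {X : Set V} {R : G.Ray} {C : G.ComponentCompl X} :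
    R.HasTailIn C ↔ ∀ᶠ n in atTop, R.vert n ∈ (C : Set V) :=
  eventually_atTop.symm

/-- A ray crosses a finite boundary only finitely often. -/
theorem Ray.eventually_mem_or_notMem (R : G.Ray) {D : Set V} (hD : (G.outerBoundary D).Finite) :
    (∀ᶠ n in atTop, R.vert n ∈ D) ∨ ∀ᶠ n in atTop, R.vert n ∉ D := by
  obtain ⟨N, hN⟩ := eventually_atTop.1 (R.eventually_notMem hD)
  by_cases h : ∃ n, N ≤ n ∧ R.vert n ∈ D
  · obtain ⟨n, hn, hnD⟩ := h
    refine Or.inl (eventually_atTop.2 ⟨n, fun i hi => ?_⟩)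
    induction i, hi using Nat.le_induction with
    | base => exact hnD
    | succ i hi ih =>
      by_contra hout
      exact hN (i + 1) (by omega) ⟨hout, _, ih, R.adj i⟩
  · push Not at h
    exact Or.inr (eventually_atTop.2 ⟨N, h⟩)

theorem isConnectedSet_componentCompl {X : Set V} (C : G.ComponentCompl X) :
    G.IsConnectedSet (C : Set V) := by
  classical
  intro a ha b hb
  obtain ⟨p, hp⟩ := Ray.exists_walk_of_mem_component ha hb
  exact ⟨p, fun x hx => Ray.mem_component_of_walk C (p.takeUntil x hx)
    (fun w hw => hp w (p.support_takeUntil_subset_support hx hw)) ha⟩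

theorem outerBoundary_componentCompl_subset {X : Set V} (C : G.ComponentCompl X) :
    G.outerBoundary (C : Set V) ⊆ X := by
  rintro x ⟨hx, y, hy, hyx⟩
  by_contra hxX
  exact hx (ComponentCompl.mem_of_adj _ _ hy hxX hyx)

theorem disjoint_componentCompl {X : Set V} (C : G.ComponentCompl X) :
    Disjoint (C : Set V) X :=
  C.disjoint_right.symm

namespace EndSpace

theorem exists_mk (ω : G.EndSpace) : ∃ R, mk R = ω := Quotient.exists_rep ω

/-- The set of ends that live in the vertex set `D`, that is, have a ray with a tail in `D`. When
the boundary of `D` is finite, all rays of such an end have a tail in `D`. -/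
def livingIn (D : Set V) : Set G.EndSpace :=
  {ω | ∃ R : G.Ray, mk R = ω ∧ ∀ᶠ n in atTop, R.vert n ∈ D}

theorem livingIn_mono {D E : Set V} (h : D ⊆ E) : livingIn (G := G) D ⊆ livingIn E := by
  rintro _ ⟨R, rfl, hR⟩
  exact ⟨R, rfl, hR.mono fun _ hn => h hn⟩

/-- Whether an end lives in `D` depends only on its component of `G - X`, where `X` is the boundary
of `D`. -/
theorem eventually_mem_of_component_eq {D : Set V} (hD : (G.outerBoundary D).Finite)
    {R : G.Ray} {ω : G.EndSpace} (hω : ω ∈ livingIn D)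
    (h : component hD.toFinset (mk R) = component hD.toFinset ω) :
    ∀ᶠ n in atTop, R.vert n ∈ D := by
  obtain ⟨S, rfl, hS⟩ := hω
  have hRC := Ray.hasTailIn_iff.1 (component_mk_eq_iff.1 h)
  have hSC := Ray.hasTailIn_iff.1
    (component_mk_eq_iff.1 (rfl : component hD.toFinset (mk S) = _))
  obtain ⟨n, hnC, hnD⟩ := (hSC.and hS).exists
  have hsub : (component hD.toFinset (mk S) : Set V) ⊆ D := by
    refine (isConnectedSet_componentCompl _).subset_of_disjoint ?_ ⟨_, hnC, hnD⟩
    simpa using disjoint_componentCompl (component hD.toFinset (mk S))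
  exact hRC.mono fun _ hn => hsub hn

theorem mk_mem_livingIn {D : Set V} (hD : (G.outerBoundary D).Finite) {R : G.Ray} :
    mk R ∈ livingIn D ↔ ∀ᶠ n in atTop, R.vert n ∈ D :=
  ⟨fun h => eventually_mem_of_component_eq hD h rfl, fun h => ⟨R, rfl, h⟩⟩

theorem livingIn_union_subset {D E : Set V} (hD : (G.outerBoundary D).Finite) :
    livingIn (G := G) (D ∪ E) ⊆ livingIn D ∪ livingIn E := by
  rintro _ ⟨R, rfl, hR⟩
  rcases R.eventually_mem_or_notMem hD with h | h
  · exact Or.inl ⟨R, rfl, h⟩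
  · refine Or.inr ⟨R, rfl, ?_⟩
    filter_upwards [hR, h] with n h1 h2 using h1.resolve_left h2

theorem endsIn_eq_livingIn {X : Finset V} (C : G.ComponentCompl (X : Set V)) :
    endsIn X C = livingIn (C : Set V) := by
  ext ω
  constructor
  · intro h
    obtain ⟨R, rfl⟩ := exists_mk ω
    exact ⟨R, rfl, Ray.hasTailIn_iff.1 (component_mk_eq_iff.1 h)⟩
  · rintro ⟨R, rfl, hR⟩
    exact component_mk_eq_iff.2 (Ray.hasTailIn_iff.2 hR)

theorem mem_livingIn_component (X : Finset V) (ω : G.EndSpace) :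
    ω ∈ livingIn (component X ω : Set V) := by
  rw [← endsIn_eq_livingIn]
  rfl

theorem isOpen_endsIn (X : Finset V) (C : G.ComponentCompl (X : Set V)) :
    IsOpen (endsIn X C) :=
  isTopologicalBasis.isOpen ⟨X, C, rfl⟩

theorem isClopen_endsIn (X : Finset V) (C : G.ComponentCompl (X : Set V)) :
    IsClopen (endsIn X C) := by
  refine ⟨⟨?_⟩, isOpen_endsIn X C⟩
  refine isOpen_iff_mem_nhds.2 fun ω hω => ?_
  refine mem_nhds_iff.2 ⟨endsIn X (component X ω), fun η hη h => hω ?_, isOpen_endsIn _ _, rfl⟩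
  exact (hη : component X η = component X ω).symm.trans h

theorem t2Space : T2Space G.EndSpace := by
  refine ⟨fun ω η hne => ?_⟩
  obtain ⟨X, hX⟩ : ∃ X, component X ω ≠ component X η := by
    by_contra! h
    obtain ⟨R, rfl⟩ := exists_mk ω
    obtain ⟨S, rfl⟩ := exists_mk η
    refine hne (mk_eq_mk.2 (Ray.equivalent_iff.2 fun X => ⟨_, component_mk_eq_iff.1 (h X), ?_⟩))
    exact component_mk_eq_iff.1 rfl
  refine ⟨_, _, isOpen_endsIn X (component X ω), isOpen_endsIn X (component X η), rfl, rfl, ?_⟩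
  exact Set.disjoint_left.2 fun θ h1 h2 => hX ((h1 : component X θ = _).symm.trans h2)

theorem exists_mk_eq_forall_mem {D : Set V} {ω : G.EndSpace} (h : ω ∈ livingIn D) :
    ∃ R : G.Ray, mk R = ω ∧ ∀ n, R.vert n ∈ D := by
  obtain ⟨R, rfl, hR⟩ := h
  obtain ⟨N, hN⟩ := eventually_atTop.1 hR
  refine ⟨⟨fun n => R.vert (n + N), fun m n h => ?_, fun n => ?_⟩, ?_, fun n => hN _ (by omega)⟩
  · have := R.injective h
    omega
  · have := R.adj (n + N)
    rwa [Nat.add_right_comm] at this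
  · refine mk_eq_mk.2 (Ray.equivalent_iff.2 fun X => ?_)
    obtain ⟨C, M, hM⟩ := R.exists_hasTailIn X
    exact ⟨C, ⟨M, fun n hn => hM _ (by omega)⟩, M, hM⟩

/-! ### Good sets of vertices -/

/-- With respect to a family `B` of sets of ends, a vertex set is good if its boundary is finite
and finitely many members of `B` cover the ends that live in it. -/
def Good (B : Set (Set G.EndSpace)) (D : Set V) : Prop :=
  (G.outerBoundary D).Finite ∧ ∃ T ⊆ B, T.Finite ∧ livingIn D ⊆ ⋃₀ T

theorem Good.subset {B : Set (Set G.EndSpace)} {D E : Set V} (hE : Good B E) (hDE : D ⊆ E)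
    (hD : (G.outerBoundary D).Finite) : Good B D := by
  obtain ⟨-, T, hTB, hT, h⟩ := hE
  exact ⟨hD, T, hTB, hT, (livingIn_mono hDE).trans h⟩

theorem Good.union {B : Set (Set G.EndSpace)} {D E : Set V} (hD : Good B D) (hE : Good B E) :
    Good B (D ∪ E) := by
  obtain ⟨hDf, T, hTB, hT, h⟩ := hD
  obtain ⟨hEf, T', hTB', hT', h'⟩ := hE
  refine ⟨((hDf.subset Set.sdiff_subset).union (hEf.subset Set.sdiff_subset)).subset
    (outerBoundary_union_subset D E), T ∪ T', Set.union_subset hTB hTB', hT.union hT', ?_⟩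
  rw [Set.sUnion_union]
  exact (livingIn_union_subset hDf).trans (Set.union_subset_union h h')

/-- Let every vertex of `M` that lies in a good set lie in a good set with boundary in `M`. If a
ray inside `M` has a tail in a good set, then it has a tail in a good set with boundary in `M`. -/
theorem Good.exists_outerBoundary_subset {B : Set (Set G.EndSpace)} {M : Set V}
    (hM : ∀ v ∈ M, (∃ D, Good B D ∧ v ∈ D) → ∃ E, Good B E ∧ v ∈ E ∧ G.outerBoundary E ⊆ M)
    {R : G.Ray} (hR : ∀ᶠ n in atTop, R.vert n ∈ M)
    (hgood : ∃ D, Good B D ∧ ∀ᶠ n in atTop, R.vert n ∈ D) :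
    ∃ D, Good B D ∧ (∀ᶠ n in atTop, R.vert n ∈ D) ∧ G.outerBoundary D ⊆ M := by
  -- `D` is chosen with as few boundary vertices outside `M` as possible.
  obtain ⟨D, ⟨hD, hRD⟩, hmin⟩ := exists_minimalFor_of_wellFoundedLT
    (fun D => Good B D ∧ ∀ᶠ n in atTop, R.vert n ∈ D)
    (fun D => (G.outerBoundary D \ M).ncard) hgood
  choose! E hE hvE hEM using fun v (hv : v ∈ M ∩ D) => hM v hv.1 ⟨D, hD, hv.2⟩
  have hY : (G.outerBoundary D \ M).Finite := hD.1.subset Set.sdiff_subset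
  -- By minimality of `D`, passing to `D ∪ E v` cannot remove any of those boundary vertices.
  have hdisj : ∀ v ∈ M ∩ D, ∀ y ∈ G.outerBoundary D \ M, y ∉ E v := by
    intro v hv y hy hyE
    have hsub : G.outerBoundary (D ∪ E v) \ M ⊆ (G.outerBoundary D \ M) \ E v := by
      rintro x ⟨hx, hxM⟩
      rcases outerBoundary_union_subset D (E v) hx with h | h
      · exact ⟨⟨h.1, hxM⟩, h.2⟩
      · exact absurd (hEM v hv h.1) hxM
    have hlt : (G.outerBoundary (D ∪ E v) \ M).ncard < (G.outerBoundary D \ M).ncard :=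
      Set.ncard_lt_ncard ((Set.ssubset_iff_of_subset (hsub.trans Set.sdiff_subset)).2
        ⟨y, hy, fun h => (hsub h).2 hyE⟩) hY
    exact absurd (hmin ⟨hD.union (hE v hv), hRD.mono fun _ h => Or.inl h⟩ hlt.le) (not_le.2 hlt)
  have hbd : G.outerBoundary (D ∩ ⋃ v ∈ M ∩ D, E v) ⊆ G.outerBoundary D ∩ M := by
    rintro x ⟨hx, y, ⟨hyD, hy⟩, hyx⟩
    simp only [Set.mem_iUnion, exists_prop] at hy
    obtain ⟨v, hv, hyv⟩ := hy
    by_cases hxD : x ∈ D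
    · have hxE : x ∉ E v := fun h => hx ⟨hxD, Set.mem_biUnion hv h⟩
      have hxM : x ∈ M ∩ D := ⟨hEM v hv ⟨hxE, y, hyv, hyx⟩, hxD⟩
      exact absurd ⟨hxD, Set.mem_biUnion hxM (hvE x hxM)⟩ hx
    · have hxb : x ∈ G.outerBoundary D := ⟨hxD, y, hyD, hyx⟩
      refine ⟨hxb, ?_⟩
      by_contra hxM
      exact hxM (hEM v hv ⟨hdisj v hv x ⟨hxb, hxM⟩, y, hyv, hyx⟩)
  refine ⟨D ∩ ⋃ v ∈ M ∩ D, E v, hD.subset Set.inter_subset_left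
    (hD.1.subset (hbd.trans Set.inter_subset_left)), ?_, hbd.trans Set.inter_subset_right⟩
  filter_upwards [hR, hRD] with n h1 h2
  exact ⟨h2, Set.mem_biUnion ⟨h1, h2⟩ (hvE _ ⟨h1, h2⟩)⟩

end EndSpace

/-! ### Splitting an open set of ends into pieces with finite boundary -/

/-- If a connected set `L` has infinitely many neighbours in `W`, then so does some connected
subset of `L` that avoids a given set `D` with finite boundary, provided that `D` avoids `W`. -/
theorem IsConnectedSet.exists_subset_sdiff {L D W : Set V} (hL : G.IsConnectedSet L)
    (hD : (G.outerBoundary D).Finite) (hDW : Disjoint D W)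
    (hinf : (G.outerBoundary L ∩ W).Infinite) :
    ∃ L' ⊆ L \ D, G.IsConnectedSet L' ∧ (G.outerBoundary L' ∩ W).Infinite := by
  by_cases hLD : Disjoint L D
  · exact ⟨L, fun x hx => ⟨hx, Set.disjoint_left.1 hLD hx⟩, hL, hinf⟩
  obtain ⟨d, hdL, hdD⟩ := Set.not_disjoint_iff.1 hLD
  by_contra! h
  -- Every component of `L \ D` meets the finite boundary of `D`, so there are finitely many.
  refine (hinf.sdiff hD) ((hD.biUnion (t := fun z =>
    G.outerBoundary (G.componentIn (L \ D) z) ∩ W) fun z _ => ?_).subset ?_)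
  · exact h _ componentIn_subset (isConnectedSet_componentIn _ _)
  · rintro u ⟨⟨⟨huL, y, hyL, hyu⟩, huW⟩, huD⟩
    have hyD : y ∉ D := fun hyD => huD ⟨Set.disjoint_right.1 hDW huW, y, hyD, hyu⟩
    have hy : y ∈ G.componentIn (L \ D) y := ReachableIn.refl ⟨hyL, hyD⟩
    obtain ⟨z, z', hz, hz', -, hz'L, hzz'⟩ := (hL y hyL d hdL).exists_crossing hy
      fun hd => (componentIn_subset hd).2 hdD
    have hz'D : z' ∈ D := by
      by_contra hz'D
      exact hz' (ReachableIn.trans hz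
        (ReachableIn.of_adj (componentIn_subset hz) ⟨hz'L, hz'D⟩ hzz'))
    refine Set.mem_biUnion (x := z) ⟨(componentIn_subset hz).2, z', hz'D, hzz'.symm⟩
      ⟨⟨?_, y, ?_, hyu⟩, huW⟩
    · exact fun hu => huL (componentIn_subset hu).1
    · exact ReachableIn.symm hz

/-- The vertices that can be separated from `U` by a finite set: those that lie in a set with finite
boundary that avoids `U`. -/
def separablePart (G : SimpleGraph V) (U : Set V) : Set V :=
  {x | ∃ D, (G.outerBoundary D).Finite ∧ Disjoint D U ∧ x ∈ D}

theorem subset_separablePart {U D : Set V} (hD : (G.outerBoundary D).Finite)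
    (hDU : Disjoint D U) : D ⊆ G.separablePart U :=
  fun _ hx => ⟨D, hD, hDU, hx⟩

theorem disjoint_separablePart (U : Set V) : Disjoint (G.separablePart U) U :=
  Set.disjoint_left.2 fun _ ⟨_, _, hDU, hx⟩ => Set.disjoint_left.1 hDU hx

/-- A component of `separablePart G U` with infinite boundary contains a ray that cannot be
separated from `U` by a finite set. -/
theorem exists_ray_of_infinite_outerBoundary {U : Set V} {x : V} (hx : x ∈ G.separablePart U)
    (hinf : (G.outerBoundary (G.componentIn (G.separablePart U) x)).Infinite) :
    ∃ R : G.Ray, (∀ n, R.vert n ∈ G.separablePart U) ∧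
      ∀ D, (G.outerBoundary D).Finite → (∀ᶠ n in atTop, R.vert n ∈ D) → ¬ Disjoint D U := by
  classical
  set W := G.separablePart U with hW
  set K := G.componentIn W x with hK
  have hE : ∀ y, ∃ E, (G.outerBoundary E).Finite ∧ Disjoint E U ∧ (y ∈ W → y ∈ E) := by
    intro y
    by_cases hy : y ∈ W
    · obtain ⟨E, h1, h2, h3⟩ := hy
      exact ⟨E, h1, h2, fun _ => h3⟩
    · exact ⟨∅, by simp [outerBoundary_empty], by simp, fun h => absurd h hy⟩
  choose E hEf hEU hE using hE
  -- An exhaustion of `K` by sets with finite boundary that avoid `U`.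
  let D : ℕ → Set V := fun n => Nat.rec (E x) (fun _ D => D ∪ ⋃ y ∈ G.outerBoundary D, E y) n
  have hDs : ∀ n, D (n + 1) = D n ∪ ⋃ y ∈ G.outerBoundary (D n), E y := fun n => rfl
  have hD : ∀ n, (G.outerBoundary (D n)).Finite ∧ Disjoint (D n) U := by
    intro n
    induction n with
    | zero => exact ⟨hEf x, hEU x⟩
    | succ n ih =>
      rw [hDs]
      refine ⟨((ih.1.subset Set.sdiff_subset).union (Set.Finite.subset ?_
        Set.sdiff_subset)).subset (outerBoundary_union_subset _ _), ?_⟩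
      · exact (ih.1.biUnion fun y _ => hEf y).subset (outerBoundary_biUnion_subset _ _)
      · rw [Set.disjoint_union_left, Set.disjoint_iUnion₂_left]
        exact ⟨ih.2, fun y _ => hEU y⟩
  have hDW : ∀ n, D n ⊆ W := fun n => subset_separablePart (hD n).1 (hD n).2
  have hKD : ∀ b ∈ K, ∃ n, b ∈ D n := by
    intro b hb
    by_contra! h
    obtain ⟨y, z, hy, hz, -, hzW, hyz⟩ := ReachableIn.exists_crossing (D := ⋃ n, D n) hb
      (Set.mem_iUnion.2 ⟨0, hE x hx⟩) (by simpa using h)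
    obtain ⟨n, hy⟩ := Set.mem_iUnion.1 hy
    refine hz (Set.mem_iUnion.2 ⟨n + 1, ?_⟩)
    rw [hDs]
    exact Or.inr (Set.mem_biUnion
      (⟨fun h => hz (Set.mem_iUnion.2 ⟨n, h⟩), y, hy, hyz⟩ : z ∈ G.outerBoundary (D n)) (hE z hzW))
  have hKW : G.outerBoundary K ∩ Wᶜ = G.outerBoundary K := Set.inter_eq_left.2 fun y hy hyW =>
    Set.disjoint_left.1 outerBoundary_componentIn_disjoint hyW hy
  -- A decreasing sequence of connected sets with infinite boundary that leaves every `D n`.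
  choose! f hfsub hfconn hfinf using fun (n : ℕ) (L : Set V)
    (hL : G.IsConnectedSet L ∧ (G.outerBoundary L ∩ Wᶜ).Infinite) =>
    hL.1.exists_subset_sdiff (hD n).1 (Set.disjoint_compl_right_iff_subset.2 (hDW n)) hL.2
  let L : ℕ → Set V := fun n => Nat.rec K (fun n L => f n L) n
  have hL : ∀ n, G.IsConnectedSet (L n) ∧ (G.outerBoundary (L n) ∩ Wᶜ).Infinite := by
    intro n
    induction n with
    | zero => exact ⟨isConnectedSet_componentIn _ _, hKW.symm ▸ hinf⟩
    | succ n ih => exact ⟨hfconn n _ ih, hfinf n _ ih⟩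
  have hLs : ∀ n, L (n + 1) ⊆ L n \ D n := fun n => hfsub n _ (hL n)
  have hanti : Antitone L := antitone_nat_of_succ_le fun n => (hLs n).trans Set.sdiff_subset
  have hout : ∀ v, ∃ n, v ∉ L n := by
    intro v
    by_cases hv : v ∈ K
    · obtain ⟨n, hn⟩ := hKD v hv
      exact ⟨n + 1, fun h => (hLs n h).2 hn⟩
    · exact ⟨0, hv⟩
  obtain ⟨R, hRK, hRL⟩ := Ray.exists_of_antitone L hanti (fun n => by
    obtain ⟨_, ⟨-, y, hy, -⟩, -⟩ := (hL n).2.nonempty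
    exact ⟨y, hy⟩) (fun n => (hL n).1) hout
  refine ⟨R, fun n => componentIn_subset (hRK n), fun A hA hRA hAU => ?_⟩
  -- Some `L n` avoids the boundary of `A` and hence lies in `A`, but has infinitely many
  -- neighbours outside `W ⊇ A`.
  choose m hm using hout
  obtain ⟨N, hN⟩ := (hA.image m).bddAbove
  have hdisj : Disjoint (L N) (G.outerBoundary A) := Set.disjoint_right.2 fun v hv hvL =>
    hm v (hanti (hN ⟨v, hv, rfl⟩) hvL)
  obtain ⟨n, hn⟩ := ((hRL N).and hRA).exists
  have hLA : L N ⊆ A := (hL N).1.subset_of_disjoint hdisj ⟨_, hn⟩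
  obtain ⟨u, ⟨⟨-, y, hy, hyu⟩, huW⟩, huA⟩ := ((hL N).2.sdiff hA).nonempty
  exact huW (subset_separablePart hA hAU
    (by_contra fun h => huA ⟨h, y, hLA hy, hyu⟩))

namespace EndSpace

/-- For an open set `O` of ends there is a set `U` of vertices that meets every ray of an end
outside `O` and that can be separated from every end in `O` by a finite set of vertices. -/
theorem exists_separating_set {O : Set G.EndSpace} (hO : IsOpen O) :
    ∃ U : Set V, (∀ R : G.Ray, mk R ∉ O → ∃ n, R.vert n ∈ U) ∧
      ∀ ω ∈ O, ∃ D, (G.outerBoundary D).Finite ∧ Disjoint D U ∧ ω ∈ livingIn D := by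
  -- `U` is the vertex set of a maximal family of disjoint rays of ends outside `O`.
  let P : Set (Set G.Ray) := {F | (∀ R ∈ F, mk R ∉ O) ∧
    ∀ R ∈ F, ∀ S ∈ F, ∀ m n, R.vert m = S.vert n → R = S}
  obtain ⟨F, hF⟩ : ∃ F, Maximal (· ∈ P) F := by
    refine zorn_subset P fun c hc hchain =>
      ⟨⋃₀ c, ⟨?_, ?_⟩, fun s hs => Set.subset_sUnion_of_mem hs⟩
    · rintro R ⟨s, hs, hR⟩
      exact (hc hs).1 R hR
    · rintro R ⟨s, hs, hR⟩ S ⟨t, ht, hS⟩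
      rcases hchain.total hs ht with h | h
      · exact (hc ht).2 R (h hR) S hS
      · exact (hc hs).2 R hR S (h hS)
  refine ⟨{v | ∃ R ∈ F, ∃ n, R.vert n = v}, fun R hR => ?_, fun ω hω => ?_⟩
  · by_contra! h
    have hR' : insert R F ∈ P := by
      refine ⟨fun S hS => ?_, fun S hS T hT m n e => ?_⟩
      · rcases hS with rfl | hS
        · exact hR
        · exact hF.prop.1 S hS
      · rcases hS with rfl | hS <;> rcases hT with rfl | hT
        · rfl
        · exact absurd ⟨T, hT, n, e.symm⟩ (h m)
        · exact absurd ⟨S, hS, m, e⟩ (h n)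
        · exact hF.prop.2 S hS T hT m n e
    exact h 0 ⟨R, hF.le_of_ge hR' (Set.subset_insert R F) (Set.mem_insert R F), 0, rfl⟩
  · obtain ⟨_, ⟨X, C, rfl⟩, hωC, hCO⟩ := isTopologicalBasis.exists_subset_of_mem_open hω hO
    rw [endsIn_eq_livingIn] at hωC hCO
    have hC : (G.outerBoundary (C : Set V)).Finite :=
      X.finite_toSet.subset (outerBoundary_componentCompl_subset C)
    -- A ray in `F` that meets `C` leaves it again, hence meets its finite boundary.
    have hmeet : ∀ R ∈ F, (∀ᶠ n in atTop, R.vert n ∉ (C : Set V)) := fun R hR =>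
      (R.eventually_mem_or_notMem hC).resolve_left fun h =>
        hF.prop.1 R hR (hCO ((mk_mem_livingIn hC).2 h))
    have hbd : ∀ R ∈ F, ∀ n, R.vert n ∈ (C : Set V) →
        ∃ k, R.vert k ∈ G.outerBoundary (C : Set V) := by
      intro R hR n hn
      by_contra! h
      obtain ⟨N, hN⟩ := eventually_atTop.1 (hmeet R hR)
      have hall : ∀ k, n ≤ k → R.vert k ∈ (C : Set V) := by
        intro k hk
        induction k, hk using Nat.le_induction with
        | base => exact hn
        | succ k hk ih => exact by_contra fun hout => h (k + 1) ⟨hout, _, ih, R.adj k⟩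
      exact hN _ (le_max_left N n) (hall _ (le_max_right N n))
    have hF' : {R ∈ F | ∃ k, R.vert k ∈ G.outerBoundary (C : Set V)}.Finite := by
      have hsub : ∀ v ∈ G.outerBoundary (C : Set V), {R ∈ F | ∃ k, R.vert k = v}.Finite :=
        fun v _ => Set.Subsingleton.finite fun R hR S hS => by
          obtain ⟨hR, m, hm⟩ := hR
          obtain ⟨hS, n, hn⟩ := hS
          exact hF.prop.2 R hR S hS m n (hm.trans hn.symm)
      refine (hC.biUnion hsub).subset ?_
      rintro R ⟨hR, k, hk⟩
      exact Set.mem_biUnion hk ⟨hR, k, rfl⟩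
    have hfin : ((C : Set V) ∩ {v | ∃ R ∈ F, ∃ n, R.vert n = v}).Finite := by
      refine (hF'.biUnion (t := fun R => R.vert '' {n | R.vert n ∈ (C : Set V)}) ?_).subset ?_
      · rintro R ⟨hR, -⟩
        obtain ⟨N, hN⟩ := eventually_atTop.1 (hmeet R hR)
        exact ((Set.finite_lt_nat N).subset fun n hn => by
          by_contra h
          exact hN n (not_lt.1 h) hn).image _
      · rintro _ ⟨hv, R, hR, n, rfl⟩
        exact Set.mem_biUnion (x := R) ⟨hR, hbd R hR n hv⟩ ⟨n, hv, rfl⟩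
    refine ⟨(C : Set V) \ {v | ∃ R ∈ F, ∃ n, R.vert n = v}, (hC.union hfin).subset ?_,
      Set.disjoint_sdiff_left, ?_⟩
    · rintro x ⟨hx, y, hy, hyx⟩
      by_cases hxC : x ∈ (C : Set V)
      · exact Or.inr ⟨hxC, by_contra fun h => hx ⟨hxC, h⟩⟩
      · exact Or.inl ⟨hxC, y, hy.1, hyx⟩
    · obtain ⟨R, rfl, hR⟩ := hωC
      refine ⟨R, rfl, ?_⟩
      filter_upwards [hR, R.eventually_notMem hfin] with n h1 h2
      exact ⟨h1, fun h => h2 ⟨h1, h⟩⟩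

/-- An open set `O` of ends is partitioned by the sets of ends living in the components `K` of some
set of vertices, where each `K` has finite boundary. -/
theorem exists_componentIn_partition {O : Set G.EndSpace} (hO : IsOpen O) :
    ∃ K : G.EndSpace → Set V, ∀ ω ∈ O, (G.outerBoundary (K ω)).Finite ∧ ω ∈ livingIn (K ω) ∧
      livingIn (K ω) ⊆ O ∧ ∀ η ∈ livingIn (K ω), K η = K ω := by
  obtain ⟨U, hU, hUO⟩ := exists_separating_set hO
  have hfree : ∀ R : G.Ray, (∀ n, R.vert n ∈ G.separablePart U) → mk R ∈ O := by
    intro R hR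
    by_contra h
    obtain ⟨n, hn⟩ := hU R h
    exact Set.disjoint_left.1 (disjoint_separablePart U) (hR n) hn
  have hfin : ∀ x ∈ G.separablePart U,
      (G.outerBoundary (G.componentIn (G.separablePart U) x)).Finite := by
    intro x hx
    by_contra hinf
    obtain ⟨R, hRW, hR⟩ := exists_ray_of_infinite_outerBoundary hx hinf
    obtain ⟨D, hD, hDU, hRD⟩ := hUO _ (hfree R hRW)
    exact hR D hD ((mk_mem_livingIn hD).1 hRD) hDU
  have hex : ∀ ω ∈ O, ∃ x ∈ G.separablePart U,
      ω ∈ livingIn (G.componentIn (G.separablePart U) x) := by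
    intro ω hω
    obtain ⟨D, hD, hDU, hωD⟩ := hUO ω hω
    obtain ⟨R, rfl, hR⟩ := exists_mk_eq_forall_mem hωD
    have hRW : ∀ n, R.vert n ∈ G.separablePart U := fun n => subset_separablePart hD hDU (hR n)
    refine ⟨R.vert 0, hRW 0, R, rfl, Eventually.of_forall fun n => ?_⟩
    induction n with
    | zero => exact ReachableIn.refl (hRW 0)
    | succ n ih => exact ReachableIn.trans ih (ReachableIn.of_adj (hRW n) (hRW _) (R.adj n))
  rcases (isEmpty_or_nonempty V).symm with hV | hV
  · choose! x hxW hx using hex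
    refine ⟨fun ω => G.componentIn (G.separablePart U) (x ω), fun ω hω => ?_⟩
    have hsub : livingIn (G.componentIn (G.separablePart U) (x ω)) ⊆ O := by
      intro η hη
      obtain ⟨R, rfl, hR⟩ := exists_mk_eq_forall_mem hη
      exact hfree R fun n => componentIn_subset (hR n)
    refine ⟨hfin _ (hxW ω hω), hx ω hω, hsub, fun η hη => ?_⟩
    have hηO := hsub hη
    obtain ⟨R, rfl, hR⟩ := hη
    have hR' := (mk_mem_livingIn (hfin _ (hxW _ hηO))).1 (hx _ hηO)
    obtain ⟨n, h1, h2⟩ := (hR.and hR').exists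
    exact (componentIn_eq_of_mem h2).symm.trans (componentIn_eq_of_mem h1)
  · refine ⟨fun _ => ∅, fun ω _ => ?_⟩
    obtain ⟨R, -⟩ := exists_mk ω
    exact (hV.false (R.vert 0)).elim

/-! ### Reaching good components by deleting finite sets -/

/-- One step of the deletion process: given the finite set `X` deleted so far and a connected set
`C`, such as a component of `G - X`, there is a larger finite set `Y` that contains the boundaries
of the sets `E v` for `v ∈ X` and meets `C` in a non-empty connected set which contains a neighbour
of every boundary vertex of `C`. -/
theorem exists_next {E : V → Set V} (hE : ∀ v, (G.outerBoundary (E v)).Finite) (X : Finset V)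
    {C : Set V} (hC : G.IsConnectedSet C) (hCf : (G.outerBoundary C).Finite)
    (hCne : C.Nonempty) :
    ∃ Y : Finset V, X ⊆ Y ∧ (∀ v ∈ X, G.outerBoundary (E v) ⊆ Y) ∧
      G.IsConnectedSet ((Y : Set V) ∩ C) ∧ ((Y : Set V) ∩ C).Nonempty ∧
      ∀ x ∈ G.outerBoundary C, ∃ y ∈ (Y : Set V) ∩ C, G.Adj x y := by
  obtain ⟨c, hc⟩ := hCne
  have hnb : ∀ x, ∃ y ∈ C, x ∈ G.outerBoundary C → G.Adj x y := by
    intro x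
    by_cases hx : x ∈ G.outerBoundary C
    · obtain ⟨-, y, hy, hyx⟩ := hx
      exact ⟨y, hy, fun _ => hyx.symm⟩
    · exact ⟨c, hc, fun h => absurd h hx⟩
  choose g hgC hg using hnb
  have hB : ((X : Set V) ∪ ⋃ v ∈ (X : Set V), G.outerBoundary (E v)).Finite :=
    X.finite_toSet.union (X.finite_toSet.biUnion fun v _ => hE v)
  set B := (X : Set V) ∪ ⋃ v ∈ (X : Set V), G.outerBoundary (E v)
  obtain ⟨A, hA, hQA, hAC, hAconn⟩ := hC.exists_finite_isConnectedSet
    (Q := (B ∩ C) ∪ insert c (g '' G.outerBoundary C))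
    ((hB.subset Set.inter_subset_left).union ((hCf.image g).insert c))
    (Set.union_subset Set.inter_subset_right
      (Set.insert_subset hc (Set.image_subset_iff.2 fun x _ => hgC x)))
  have hYC : (((hB.union hA).toFinset : Finset V) : Set V) ∩ C = A := by
    rw [Set.Finite.coe_toFinset, Set.union_inter_distrib_right, Set.inter_eq_left.2 hAC]
    exact Set.union_eq_right.2 (Set.subset_union_left.trans hQA)
  refine ⟨(hB.union hA).toFinset, fun v hv => ?_, fun v hv x hx => ?_, ?_, ?_, ?_⟩
  · exact (Set.Finite.mem_toFinset _).2 (Or.inl (Or.inl hv))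
  · exact (Set.Finite.mem_toFinset _).2 (Or.inl (Or.inr (Set.mem_biUnion hv hx)))
  · rwa [hYC]
  · rw [hYC]
    exact ⟨c, hQA (Or.inr (Set.mem_insert _ _))⟩
  · intro x hx
    rw [hYC]
    exact ⟨g x, hQA (Or.inr (Set.mem_insert_of_mem _ ⟨x, hx, rfl⟩)), hg x hx⟩

theorem component_nonempty (X : Finset V) (ω : G.EndSpace) :
    (component X ω : Set V).Nonempty := by
  obtain ⟨R, -, h⟩ := mem_livingIn_component X ω
  obtain ⟨n, hn⟩ := h.exists
  exact ⟨_, hn⟩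

theorem finite_outerBoundary_component (X : Finset V) (ω : G.EndSpace) :
    (G.outerBoundary (component X ω : Set V)).Finite :=
  X.finite_toSet.subset (outerBoundary_componentCompl_subset _)

theorem component_subset_of_mem_livingIn {X : Finset V} {D : Set V} {ω : G.EndSpace}
    (hX : G.outerBoundary D ⊆ X) (hω : ω ∈ livingIn D) : (component X ω : Set V) ⊆ D := by
  have hD : (G.outerBoundary D).Finite := X.finite_toSet.subset hX
  obtain ⟨R, rfl, hR⟩ := mem_livingIn_component X ω
  obtain ⟨n, hn⟩ := (hR.and ((mk_mem_livingIn hD).1 hω)).exists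
  exact (isConnectedSet_componentCompl _).subset_of_disjoint
    ((disjoint_componentCompl _).mono_right hX) ⟨_, hn⟩

/-- Let `X 0 ⊆ X 1 ⊆ ...` be obtained by iterating `exists_next` along the components in which the
end `ω` lives. If all ends living in the first of these components live in a good set, then one of
these components is good. -/
theorem exists_good_component {B : Set (Set G.EndSpace)} {E : V → Set V}
    (hE : ∀ v, (∃ D, Good B D ∧ v ∈ D) → Good B (E v) ∧ v ∈ E v) {X : ℕ → Finset V}
    {ω : G.EndSpace}
    (hgood : ∀ η : G.EndSpace, η ∈ livingIn (component (X 0) ω : Set V) →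
      ∃ D, Good B D ∧ η ∈ livingIn D)
    (hsub : ∀ n, X n ⊆ X (n + 1))
    (hXE : ∀ n, ∀ v ∈ X n, G.outerBoundary (E v) ⊆ X (n + 1))
    (hconn : ∀ n, G.IsConnectedSet ((X (n + 1) : Set V) ∩ component (X n) ω))
    (hne : ∀ n, ((X (n + 1) : Set V) ∩ component (X n) ω).Nonempty)
    (hadj : ∀ n, ∀ x ∈ G.outerBoundary (component (X n) ω : Set V),
      ∃ y ∈ (X (n + 1) : Set V) ∩ component (X n) ω, G.Adj x y) :
    ∃ n, Good B (component (X n) ω : Set V) := by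
  have hXmono : Monotone X := monotone_nat_of_le_succ hsub
  set C : ℕ → Set V := fun n => (component (X n) ω : Set V) with hC
  have hCX : ∀ n, Disjoint (C n) (X n) := fun n => disjoint_componentCompl _
  have hCb : ∀ n, G.outerBoundary (C n) ⊆ X n := fun n => outerBoundary_componentCompl_subset _
  have hCconn : ∀ n, G.IsConnectedSet (C n) := fun n => isConnectedSet_componentCompl _
  have hCanti : Antitone C := fun m n hmn => component_subset_of_mem_livingIn
    ((hCb m).trans (hXmono hmn)) (mem_livingIn_component _ _)
  set F : ℕ → Set V := fun n => (X (n + 1) : Set V) ∩ C n with hF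
  -- The finite connected layers `F n` are disjoint, and consecutive ones are adjacent.
  have hFC : ∀ n, Disjoint (F n) (C (n + 1)) := fun n =>
    (hCX (n + 1)).symm.mono_left Set.inter_subset_left
  have hFF : ∀ n, ∃ x ∈ F n, ∃ y ∈ F (n + 1), G.Adj x y := by
    intro n
    obtain ⟨a, ha⟩ := component_nonempty (X (n + 1)) ω
    obtain ⟨b, hb⟩ := hne n
    obtain ⟨x, y, hx, hy, -, hyC, hxy⟩ := (hCconn n a (hCanti n.le_succ ha) b hb.2).exists_crossing
      (D := C (n + 1)) ha (Set.disjoint_left.1 (hFC n) hb)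
    have hyb : y ∈ G.outerBoundary (C (n + 1)) := ⟨hy, x, hx, hxy⟩
    obtain ⟨z, hz, hyz⟩ := hadj (n + 1) y hyb
    exact ⟨y, ⟨hCb _ hyb, hyC⟩, z, hz, hyz⟩
  set A : ℕ → Set V := fun n => {v | ∃ i, n ≤ i ∧ v ∈ F i} with hA
  have hAC : ∀ n, A n ⊆ C n := fun n v ⟨i, hi, hv⟩ => hCanti hi hv.2
  have hAanti : Antitone A := fun m n hmn v ⟨i, hi, hv⟩ => ⟨i, hmn.trans hi, hv⟩
  have hAempty : ∀ v, ∃ n, v ∉ A n := by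
    intro v
    by_cases hv : v ∈ A 0
    · obtain ⟨i, -, hi⟩ := hv
      exact ⟨i + 1, fun h => Set.disjoint_left.1 (hFC i) hi (hAC _ h)⟩
    · exact ⟨0, hv⟩
  have hAconn : ∀ n, G.IsConnectedSet (A n) := by
    intro n
    have hsub : ∀ i, n ≤ i → F i ⊆ A n := fun i hi v hv => ⟨i, hi, hv⟩
    obtain ⟨b, hb⟩ := hne n
    have key : ∀ i, n ≤ i → ∀ v ∈ F i, G.ReachableIn (A n) b v := by
      intro i hi
      induction i, hi using Nat.le_induction with
      | base => exact fun v hv => (hconn n b hb v hv).mono (hsub n le_rfl)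
      | succ i hi ih =>
        intro v hv
        obtain ⟨x, hx, y, hy, hxy⟩ := hFF i
        have hi' : n ≤ i + 1 := hi.trans i.le_succ
        exact ((ih x hx).trans (ReachableIn.of_adj (hsub i hi hx) (hsub _ hi' hy) hxy)).trans
          ((hconn (i + 1) y hy v hv).mono (hsub _ hi'))
    rintro v ⟨i, hi, hv⟩ w ⟨j, hj, hw⟩
    exact (key i hi v hv).symm.trans (key j hj w hw)
  -- A ray through the layers; its end lives in every `C n`, though it may differ from `ω`.
  obtain ⟨R, hRA, hRtail⟩ := Ray.exists_of_antitone A hAanti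
    (fun n => (hne n).mono fun v hv => ⟨n, le_rfl, hv⟩) hAconn hAempty
  have hRC : ∀ n, ∀ᶠ i in atTop, R.vert i ∈ C n := fun n => (hRtail n).mono fun i hi => hAC n hi
  obtain ⟨D, hD, hRD⟩ := hgood (mk R) ⟨R, rfl, hRC 0⟩
  obtain ⟨D', hD', hRD', hD'X⟩ := Good.exists_outerBoundary_subset (B := B)
    (M := ⋃ n, (X n : Set V)) (fun v hv hex => by
      obtain ⟨n, hn⟩ := Set.mem_iUnion.1 hv
      exact ⟨E v, (hE v hex).1, (hE v hex).2,
        (hXE n v hn).trans (Set.subset_iUnion (fun n => (X n : Set V)) (n + 1))⟩)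
    (R := R) (Eventually.of_forall fun n => by
      obtain ⟨i, -, hi⟩ := hRA n
      exact Set.mem_iUnion.2 ⟨i + 1, hi.1⟩)
    ⟨D, hD, (mk_mem_livingIn hD.1).1 hRD⟩
  obtain ⟨n, hn⟩ : ∃ n, (hD'.1.toFinset : Set V) ⊆ X n :=
    Directed.exists_mem_subset_of_finset_subset_biUnion
      (Monotone.directed_le fun i j hij => Finset.coe_subset.2 (hXmono hij)) (by simpa using hD'X)
  rw [Set.Finite.coe_toFinset] at hn
  refine ⟨n, hD'.subset ?_ (finite_outerBoundary_component _ _)⟩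
  obtain ⟨i, hi⟩ := ((hRC n).and hRD').exists
  exact (hCconn n).subset_of_disjoint ((hCX n).mono_right hn) ⟨_, hi⟩

/-- The finite sets of vertices obtained from `X₀` by applying `F` repeatedly along the components
in which the end `ω` lives. -/
noncomputable def deletion (F : Finset V → Set V → Finset V) (X₀ : Finset V) (ω : G.EndSpace) :
    ℕ → Finset V
  | 0 => X₀
  | n + 1 => F (deletion F X₀ ω n) (component (deletion F X₀ ω n) ω : Set V)

/-- Two ends that live in the same component after `n` deletions have undergone the same deletions
so far. -/
theorem deletion_eq {F : Finset V → Set V → Finset V} (hF : ∀ X (ω : G.EndSpace),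
      X ⊆ F X (component X ω : Set V)) {X₀ : Finset V} {ω η : G.EndSpace} {n : ℕ}
    (h : component (deletion F X₀ ω n) η = component (deletion F X₀ ω n) ω) :
    ∀ i ≤ n, deletion F X₀ η i = deletion F X₀ ω i := by
  have hmono : Monotone (deletion F X₀ ω) := monotone_nat_of_le_succ fun i => hF _ _
  intro i
  induction i with
  | zero => exact fun _ => rfl
  | succ i ih =>
    intro hi
    rw [deletion, deletion, ih (by omega), component_eq_of_subset (hmono (by omega : i ≤ n)) h]

/-- If the open set `O` of ends is covered by members of `B` that are of the form `endsIn X C`, then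
`O` is partitioned by the open sets `p ω`, each covered by finitely many members of `B`. -/
theorem exists_finitely_covered_partition {O : Set G.EndSpace} (hO : IsOpen O)
    {B : Set (Set G.EndSpace)} (hB : ∀ ω ∈ O, ∃ X C, endsIn X C ∈ B ∧ ω ∈ endsIn X C) :
    ∃ p : G.EndSpace → Set G.EndSpace, ∀ ω ∈ O, IsOpen (p ω) ∧ ω ∈ p ω ∧ p ω ⊆ O ∧
      (∀ η ∈ p ω, p η = p ω) ∧ ∃ T ⊆ B, T.Finite ∧ p ω ⊆ ⋃₀ T := by
  classical
  have hgood : ∀ ω ∈ O, ∃ D, Good B D ∧ ω ∈ livingIn D := by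
    intro ω hω
    obtain ⟨X, C, hXC, hωC⟩ := hB ω hω
    rw [endsIn_eq_livingIn] at hXC hωC
    exact ⟨C, ⟨X.finite_toSet.subset (outerBoundary_componentCompl_subset C), {livingIn C},
      by simpa using hXC, Set.finite_singleton _, by simp⟩, hωC⟩
  have hE : ∀ v, ∃ E, (G.outerBoundary E).Finite ∧
      ((∃ D, Good B D ∧ v ∈ D) → Good B E ∧ v ∈ E) := by
    intro v
    by_cases h : ∃ D, Good B D ∧ v ∈ D
    · obtain ⟨D, hD, hv⟩ := h
      exact ⟨D, hD.1, fun _ => ⟨hD, hv⟩⟩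
    · exact ⟨∅, by simp [outerBoundary_empty], fun h' => absurd h' h⟩
  choose E hEf hE using hE
  choose! F hFX hFE hFconn hFne hFadj using fun (X : Finset V) (C : Set V)
    (hC : G.IsConnectedSet C ∧ (G.outerBoundary C).Finite ∧ C.Nonempty) =>
    exists_next hEf X hC.1 hC.2.1 hC.2.2
  have hcomp : ∀ (X : Finset V) (ω : G.EndSpace), G.IsConnectedSet (component X ω : Set V) ∧
      (G.outerBoundary (component X ω : Set V)).Finite ∧ (component X ω : Set V).Nonempty :=
    fun X ω => ⟨isConnectedSet_componentCompl _, finite_outerBoundary_component X ω,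
      component_nonempty X ω⟩
  have hFsub : ∀ X (ω : G.EndSpace), X ⊆ F X (component X ω : Set V) :=
    fun X ω => hFX X _ (hcomp X ω)
  obtain ⟨K, hK⟩ := exists_componentIn_partition hO
  let X₀ : G.EndSpace → Finset V := fun ω =>
    if h : (G.outerBoundary (K ω)).Finite then h.toFinset else ∅
  have hX₀ : ∀ ω ∈ O, G.outerBoundary (K ω) ⊆ X₀ ω := by
    intro ω hω
    simp [X₀, (hK ω hω).1]
  let X : G.EndSpace → ℕ → Finset V := fun ω => deletion F (X₀ ω) ω
  have hXmono : ∀ ω, Monotone (X ω) := fun ω => monotone_nat_of_le_succ fun n => hFsub _ _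
  have hex : ∀ ω ∈ O, ∃ n, Good B (component (X ω n) ω : Set V) := by
    intro ω hω
    refine exists_good_component hE (X := X ω) (fun η hη => hgood η ?_)
      (fun n => hFsub _ _) (fun n => hFE _ _ (hcomp _ ω)) (fun n => hFconn _ _ (hcomp _ ω))
      (fun n => hFne _ _ (hcomp _ ω)) (fun n => hFadj _ _ (hcomp _ ω))
    exact (hK ω hω).2.2.1
      (livingIn_mono (component_subset_of_mem_livingIn (hX₀ ω hω) (hK ω hω).2.1) hη)
  -- The deletion process for `ω` stops when a good component is reached for the first time.
  let N : G.EndSpace → ℕ := fun ω => sInf {n | Good B (component (X ω n) ω : Set V)}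
  have hN : ∀ ω ∈ O, Good B (component (X ω (N ω)) ω : Set V) := fun ω hω =>
    Nat.sInf_mem (hex ω hω)
  refine ⟨fun ω => endsIn (X ω (N ω)) (component (X ω (N ω)) ω), fun ω hω => ?_⟩
  have hK' : ∀ η ∈ endsIn (X ω (N ω)) (component (X ω (N ω)) ω), η ∈ livingIn (K ω) := by
    intro η hη
    rw [endsIn_eq_livingIn] at hη
    exact livingIn_mono (component_subset_of_mem_livingIn
      ((hX₀ ω hω).trans (hXmono ω (Nat.zero_le _))) (hK ω hω).2.1) hη
  refine ⟨isOpen_endsIn _ _, rfl, fun η hη => (hK ω hω).2.2.1 (hK' η hη), fun η hη => ?_, ?_⟩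
  · have hX₀η : X₀ η = X₀ ω := by
      simp only [X₀, (hK ω hω).2.2.2 η (hK' η hη)]
    have hXη : ∀ i ≤ N ω, X η i = X ω i := by
      intro i hi
      simp only [X, hX₀η]
      exact deletion_eq hFsub hη i hi
    have hCη : ∀ i ≤ N ω, component (X ω i) η = component (X ω i) ω := fun i hi =>
      component_eq_of_subset (hXmono ω hi) hη
    have hGη : ∀ i ≤ N ω, (Good B (component (X η i) η : Set V) ↔
        Good B (component (X ω i) ω : Set V)) := by
      intro i hi
      rw [hXη i hi, hCη i hi]
    have hNη : N η = N ω := by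
      have h1 : N η ≤ N ω := Nat.sInf_le ((hGη _ le_rfl).2 (hN ω hω))
      exact le_antisymm h1 (Nat.sInf_le ((hGη _ h1).1
        (hN η ((hK ω hω).2.2.1 (hK' η hη)))))
    change endsIn (X η (N η)) (component (X η (N η)) η) = _
    rw [hNη, hXη _ le_rfl, hCη _ le_rfl]
  · obtain ⟨-, T, hTB, hT, h⟩ := hN ω hω
    exact ⟨T, hTB, hT, (endsIn_eq_livingIn _).subset.trans h⟩

end EndSpace

end SimpleGraph

/-! ### Open partitions -/

/-- A map whose non-empty fibres are open and refine `U` yields an open partition refining `U`. -/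
theorem exists_open_partition_of_fibers {X : Type*} {α : Type*} [TopologicalSpace X]
    (U : Set (Set X)) (f : X → α)
    (hf : ∀ x, IsOpen {y | f y = f x} ∧ ∃ u ∈ U, {y | f y = f x} ⊆ u) :
    ∃ P : Set (Set X), Setoid.IsPartition P ∧ (∀ p ∈ P, IsOpen p) ∧ ∀ p ∈ P, ∃ u ∈ U, p ⊆ u := by
  refine ⟨(Setoid.ker f).classes, Setoid.isPartition_classes _, ?_, ?_⟩
  · rintro _ ⟨x, rfl⟩
    exact (hf x).1
  · rintro _ ⟨x, rfl⟩
    exact (hf x).2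

theorem mainTheorem9 {V : Type u} (G : SimpleGraph V) :
    HereditarilyUltraParacompactSpace G.EndSpace := by
  classical
  intro S
  have := SimpleGraph.EndSpace.t2Space (G := G)
  refine ⟨inferInstance, fun U hU hcov => ?_⟩
  -- The basic open sets whose trace on `S` refines the cover, and the open set they cover.
  let B : Set (Set G.EndSpace) := {b | (∃ X C, b = SimpleGraph.EndSpace.endsIn X C) ∧
    ∃ u ∈ U, (Subtype.val ⁻¹' b : Set S) ⊆ u}
  have hBclopen : ∀ b ∈ B, IsClopen b := by
    rintro _ ⟨⟨X, C, rfl⟩, -⟩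
    exact SimpleGraph.EndSpace.isClopen_endsIn X C
  have hSB : ∀ ω ∈ S, ω ∈ ⋃₀ B := by
    intro ω hω
    obtain ⟨u, huU, hu⟩ : (⟨ω, hω⟩ : S) ∈ ⋃₀ U := hcov ▸ Set.mem_univ _
    obtain ⟨W, hW, rfl⟩ := isOpen_induced_iff.1 (hU u huU)
    obtain ⟨b, hb, hωb, hbW⟩ :=
      SimpleGraph.EndSpace.isTopologicalBasis.exists_subset_of_mem_open hu hW
    exact ⟨b, ⟨hb, _, huU, Set.preimage_mono hbW⟩, hωb⟩
  obtain ⟨p, hp⟩ := SimpleGraph.EndSpace.exists_finitely_covered_partition (B := B)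
    (isOpen_sUnion fun b hb => (hBclopen b hb).isOpen) (by
      rintro ω ⟨b, hb, hωb⟩
      obtain ⟨X, C, rfl⟩ := hb.1
      exact ⟨X, C, hb, hωb⟩)
  -- Each `p ω` is divided further according to which of the finitely many members of `B` that cover
  -- it contain a given end.
  let T : Set G.EndSpace → Set (Set G.EndSpace) := fun q =>
    if h : ∃ T ⊆ B, T.Finite ∧ q ⊆ ⋃₀ T then h.choose else ∅
  have hT : ∀ ω ∈ S, T (p ω) ⊆ B ∧ (T (p ω)).Finite ∧ p ω ⊆ ⋃₀ T (p ω) := by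
    intro ω hω
    have h := (hp ω (hSB ω hω)).2.2.2.2
    simp only [T, dif_pos h]
    exact h.choose_spec
  refine exists_open_partition_of_fibers U
    (fun ω : S => (p ω, {t | t ∈ T (p ω) ∧ (ω : G.EndSpace) ∈ t})) fun ω => ?_
  obtain ⟨hopen, hmem, -, hconst, -⟩ := hp ω (hSB ω ω.2)
  obtain ⟨hTB, hTf, hTc⟩ := hT ω ω.2
  have hfiber : {η : S | (p η, {t | t ∈ T (p η) ∧ (η : G.EndSpace) ∈ t}) =
      (p ω, {t | t ∈ T (p ω) ∧ (ω : G.EndSpace) ∈ t})} =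
      Subtype.val ⁻¹' (p ω ∩ ⋂ t ∈ T (p ω), {η | η ∈ t ↔ (ω : G.EndSpace) ∈ t}) := by
    ext η
    simp only [Set.mem_ofPred_eq, Prod.mk.injEq, Set.mem_preimage, Set.mem_inter_iff,
      Set.mem_iInter]
    constructor
    · rintro ⟨h1, h2⟩
      refine ⟨h1 ▸ (hp η (hSB η η.2)).2.1, fun t ht => ?_⟩
      rw [h1] at h2
      have := Set.ext_iff.1 h2 t
      simpa [ht] using this
    · rintro ⟨h1, h2⟩
      have h := hconst η h1
      refine ⟨h, ?_⟩
      rw [h]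
      ext t
      exact and_congr_right fun ht => h2 t ht
  rw [hfiber]
  constructor
  · refine (hopen.inter (hTf.isOpen_biInter fun t ht => ?_)).preimage continuous_subtype_val
    by_cases hωt : (ω : G.EndSpace) ∈ t
    · simpa [hωt] using (hBclopen t (hTB ht)).isOpen
    · simp only [hωt, iff_false]
      exact (hBclopen t (hTB ht)).compl.isOpen
  · obtain ⟨t, ht, hωt⟩ := hTc hmem
    obtain ⟨-, u, hu, htu⟩ := hTB ht
    refine ⟨u, hu, fun η hη => htu ?_⟩
    exact (Set.mem_iInter₂.1 hη.2 t ht).2 hωt
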